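/- Let $n\ge 0$ and let $\gamma$ be the standard complex Gaussian measure on $\mathbb{C}^n$, i.e. $d\gamma(w)=\pi^{-n}e^{-|w|^2}\,d\ell(w)$, where $\ell$ is Lebesgue measure on $\mathbb{C}^n\simeq\mathbb{R}^{2n}$ and $|w|^2=\sum_{i=1}^n|w_i|^2$. Let $F_1,\dots,F_N$ $(N\ge 1)$ be homogeneous polynomials in $n$ complex variables with complex coefficients (of possibly different degrees), let $\alpha_1,\dots,\alpha_N\ge 0$ be real numbers, and let $k$ be an integer with $0\le k\le N-1$. Then all the integrals below are finite and $$\int\prod_{j=1}^{N}|F_j|^{\alpha_j}\,d\gamma\;\ge\;\Big(\int\prod_{j=1}^{k}|F_j|^{\alpha_j}\,d\gamma\Big)\Big(\int\prod_{j=k+1}^{N}|F_j|^{\alpha_j}\,d\gamma\Big)\;\ge\;\prod_{j=1}^{N}\int|F_j|^{\alpha_j}\,d\gamma,$$ with the conventions that an empty product is $1$ and $0^0=1$. -/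

import Mathlib

open MeasureTheory

/-- The standard complex Gaussian measure on `ℂⁿ`, with density
`π⁻ⁿ exp (-(|w₁|² + ⋯ + |wₙ|²))` with respect to Lebesgue measure. -/
noncomputable def stdComplexGaussian (n : ℕ) : Measure (Fin n → ℂ) :=
  (volume : Measure (Fin n → ℂ)).withDensity fun w =>
    ENNReal.ofReal ((Real.pi ^ n)⁻¹ * Real.exp (-∑ i, ‖w i‖ ^ 2))

/-- The function `w ↦ ∏ j ∈ S, |F_j(w)| ^ α_j` on `ℂⁿ`. -/
noncomputable def absPowProd {n N : ℕ} (F : Fin N → MvPolynomial (Fin n) ℂ) (α : Fin N → ℝ)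
    (S : Finset (Fin N)) (w : Fin n → ℂ) : ℝ :=
  ∏ j ∈ S, ‖MvPolynomial.eval w (F j)‖ ^ α j

/-!
For a circle invariant smooth function `g` and a smooth function `f`, both plurisubharmonic and of
temperate growth, `∫ f dγ ∫ g dγ ≤ ∫ f g dγ`. The reason is that, for a pair `(Z, Z_t)` of standard
complex Gaussian vectors with correlation `t` in the closed unit disc, `Φ(t) = E f(Z) g(Z_t)` has
`∂_t ∂_t̄ Φ(t) = E tr (Levi f(Z) · Levi g(Z_t)) ≥ 0`. So `Φ` is subharmonic; it depends on `|t|` only,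
because `g` is circle invariant, hence it increases with `|t|`, from `Φ(0) = ∫ f dγ ∫ g dγ` to
`Φ(1) = ∫ f g dγ`.

This is carried out for real correlations `t = cos s`, with `interp f g s = Φ(cos s)` and
`Z_t = cos s Z + sin s W`. Gaussian integration by parts (`integral_realCoord_mul`) gives
`Φ' = -(1/2) sin s Ψ` with `Ψ = ∑ₐ E ∂ₐf(Z) ∂ₐg(Z_t)` (`hasDerivAt_interp`), and in the same way
`Ψ' = -(1/2) sin s ∑ₐᵦ E ∂ᵦ∂ₐf(Z) ∂ᵦ∂ₐg(Z_t)`. Circle invariance enters through the derivative of the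
Euler relation `Dg(w)[iw] = 0`, which yields, again by parts,
`Ψ = (1/2) cos s ∑ₐᵦ E ∂ᵦ∂ₐf(Z) ∂_{iᵦ}∂_{iₐ}g(Z_t)` (`sum_interp_dirDeriv`). Together the two identities
say that `cos s Ψ` has derivative `-(1/2) sin s cos s` times the expectation of a trace of a product
of positive semidefinite forms (`sum_mul_leviForm_nonneg`). As `cos s Ψ` vanishes at `π / 2`, `Ψ` is
nonnegative on `[0, π / 2)` and `Φ` decreases in `s` (`IsPsh.integral_mul_le`).

The products of powers of `|F_j|` are limits of `∏ (|F_j|² + ε) ^ (α_j / 2)`, which are smooth,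
circle invariant by homogeneity, and plurisubharmonic, since the logarithm of `|F|² + ε` is
(`isLogPsh_norm_sq_add`) and this property is stable under products and nonnegative powers.
-/

open Function Filter Topology
open scoped ContDiff

/-! ### Directional derivatives and temperate growth -/

/-- The derivative of `f` in the real direction `v`, as a function of the base point. -/
noncomputable def dirDeriv {E F : Type*} [NormedAddCommGroup E] [NormedSpace ℝ E]
    [NormedAddCommGroup F] [NormedSpace ℝ F] (v : E) (f : E → F) (z : E) : F :=
  fderiv ℝ f z v

section Temperate

variable {E F : Type*} [NormedAddCommGroup E] [NormedSpace ℝ E]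
  [NormedAddCommGroup F] [NormedSpace ℝ F]

theorem Function.HasTemperateGrowth.differentiableAt {f : E → F} (hf : HasTemperateGrowth f)
    (x : E) : DifferentiableAt ℝ f x :=
  (hf.1.differentiable (by simp)).differentiableAt

theorem Function.HasTemperateGrowth.fderiv {f : E → F} (hf : HasTemperateGrowth f) :
    HasTemperateGrowth (_root_.fderiv ℝ f) := by
  refine ⟨hf.1.fderiv_right (by simp), fun n => ?_⟩
  obtain ⟨k, C, h⟩ := hf.2 (n + 1)
  refine ⟨k, C, fun x => ?_⟩
  rw [norm_iteratedFDeriv_fderiv]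
  exact h x

theorem Function.HasTemperateGrowth.dirDeriv {f : E → F} (hf : HasTemperateGrowth f) (v : E) :
    HasTemperateGrowth (dirDeriv v f) :=
  (ContinuousLinearMap.hasTemperateGrowth (ContinuousLinearMap.apply ℝ F v)).comp hf.fderiv

theorem Function.HasTemperateGrowth.exists_norm_le {f : E → F} (hf : HasTemperateGrowth f) :
    ∃ (k : ℕ) (C : ℝ), 0 ≤ C ∧ ∀ x, ‖f x‖ ≤ C * (1 + ‖x‖) ^ k := by
  obtain ⟨k, C, h⟩ := hf.2 0
  refine ⟨k, C, ?_, fun x => by simpa using h x⟩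
  have h0 := (norm_nonneg _).trans (h 0)
  simpa using h0

theorem Function.HasTemperateGrowth.prod {ι : Type*} {f : ι → E → ℝ} {S : Finset ι}
    (hf : ∀ i ∈ S, HasTemperateGrowth (f i)) : HasTemperateGrowth (fun x => ∏ i ∈ S, f i x) := by
  classical
  induction S using Finset.induction_on with
  | empty => simp
  | insert i S hi ih =>
    simp only [Finset.prod_insert hi]
    exact (hf i (by simp)).mul (ih fun j hj => hf j (by simp [hj]))

theorem dirDeriv_mul {f g : E → ℝ} {z : E} (hf : DifferentiableAt ℝ f z)
    (hg : DifferentiableAt ℝ g z) (v : E) :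
    dirDeriv v (fun x => f x * g x) z = dirDeriv v f z * g z + f z * dirDeriv v g z := by
  simp only [dirDeriv]
  rw [fderiv_fun_mul hf hg]
  simp
  ring

theorem dirDeriv_dirDeriv {f : E → F} (hf : HasTemperateGrowth f) (u v z : E) :
    dirDeriv u (dirDeriv v f) z = fderiv ℝ (fderiv ℝ f) z u v := by
  have h := ((hf.fderiv.differentiableAt z).hasFDerivAt.clm_apply
    (hasFDerivAt_const v z)).fderiv
  have h2 := congrArg (fun T : E →L[ℝ] F => T u) h
  simpa [dirDeriv, Function.comp_def, show dirDeriv v f = fun z => fderiv ℝ f z v from rfl] using h2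

end Temperate

/-! ### The standard complex Gaussian measure -/

section Gaussian

variable {n : ℕ}

/-- The density of the standard complex Gaussian measure. -/
noncomputable def gaussDensity (n : ℕ) (w : Fin n → ℂ) : ℝ :=
  (Real.pi ^ n)⁻¹ * Real.exp (-∑ i, ‖w i‖ ^ 2)

theorem gaussDensity_nonneg (w : Fin n → ℂ) : 0 ≤ gaussDensity n w := by
  unfold gaussDensity; positivity

theorem continuous_gaussDensity : Continuous (gaussDensity n) := by
  unfold gaussDensity; fun_prop

theorem integral_stdComplexGaussian (f : (Fin n → ℂ) → ℝ) :
    ∫ w, f w ∂stdComplexGaussian n = ∫ w, f w * gaussDensity n w := by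
  unfold stdComplexGaussian
  rw [integral_withDensity_eq_integral_toReal_smul]
  · refine integral_congr_ae (.of_forall fun w => ?_)
    change (ENNReal.ofReal (gaussDensity n w)).toReal • f w = _
    rw [ENNReal.toReal_ofReal (gaussDensity_nonneg w), smul_eq_mul, mul_comm]
  · exact (continuous_gaussDensity (n := n)).measurable.ennreal_ofReal
  · exact .of_forall fun w => ENNReal.ofReal_lt_top

theorem integrable_stdComplexGaussian_iff (f : (Fin n → ℂ) → ℝ) :
    Integrable f (stdComplexGaussian n) ↔ Integrable (fun w => f w * gaussDensity n w) := by
  unfold stdComplexGaussian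
  rw [integrable_withDensity_iff]
  · refine integrable_congr (.of_forall fun w => ?_)
    change _ * (ENNReal.ofReal (gaussDensity n w)).toReal = _
    rw [ENNReal.toReal_ofReal (gaussDensity_nonneg w)]
  · exact (continuous_gaussDensity (n := n)).measurable.ennreal_ofReal
  · exact .of_forall fun w => ENNReal.ofReal_lt_top

/-- The density decays faster than any power, so the product is dominated by an integrable
negative power of `1 + ‖w‖`. -/
theorem integrable_one_add_norm_pow_mul_gaussDensity (k : ℕ) :
    Integrable (fun w : Fin n → ℂ => (1 + ‖w‖) ^ k * gaussDensity n w) := by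
  set K := Measure.integrablePower (volume : Measure (Fin n → ℂ)) with hK
  have hint := Measure.integrable_pow_neg_integrablePower (volume : Measure (Fin n → ℂ))
  have hexp : ∀ x : ℝ, 0 ≤ x → (1 + x) ^ (k + K) * Real.exp (-x ^ 2) ≤
      (k + K).factorial * Real.exp 2 := by
    intro x hx
    have h1 := Real.pow_div_factorial_le_exp (1 + x) (by linarith) (k + K)
    rw [div_le_iff₀ (by positivity)] at h1
    calc (1 + x) ^ (k + K) * Real.exp (-x ^ 2)
        ≤ (Real.exp (1 + x) * (k + K).factorial) * Real.exp (-x ^ 2) := by gcongr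
      _ = (k + K).factorial * Real.exp (1 + x - x ^ 2) := by
        rw [mul_right_comm, ← Real.exp_add, mul_comm]; ring_nf
      _ ≤ _ := by
        gcongr
        nlinarith [sq_nonneg (x - 1 / 2)]
  refine (hint.const_mul ((Real.pi ^ n)⁻¹ * ((k + K).factorial * Real.exp 2))).mono'
    (by apply Continuous.aestronglyMeasurable; have := continuous_gaussDensity (n := n); fun_prop)
    (.of_forall fun w => ?_)
  have hw : ‖w‖ ^ 2 ≤ ∑ i, ‖w i‖ ^ 2 := by
    have hs : 0 ≤ ∑ i, ‖w i‖ ^ 2 := by positivity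
    have : ‖w‖ ≤ Real.sqrt (∑ i, ‖w i‖ ^ 2) := by
      refine (pi_norm_le_iff_of_nonneg (Real.sqrt_nonneg _)).2 fun i => ?_
      refine Real.le_sqrt_of_sq_le ?_
      exact Finset.single_le_sum (f := fun i => ‖w i‖ ^ 2) (fun i _ => by positivity)
        (Finset.mem_univ i)
    calc ‖w‖ ^ 2 ≤ Real.sqrt (∑ i, ‖w i‖ ^ 2) ^ 2 := by gcongr
      _ = _ := Real.sq_sqrt hs
  have h1 : 0 < 1 + ‖w‖ := by positivity
  rw [Real.norm_of_nonneg (mul_nonneg (by positivity) (gaussDensity_nonneg w))]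
  rw [Real.rpow_neg h1.le, Real.rpow_natCast, ← div_eq_mul_inv, le_div_iff₀ (by positivity)]
  calc (1 + ‖w‖) ^ k * gaussDensity n w * (1 + ‖w‖) ^ K
      = (Real.pi ^ n)⁻¹ * ((1 + ‖w‖) ^ (k + K) * Real.exp (-∑ i, ‖w i‖ ^ 2)) := by
        unfold gaussDensity; ring
    _ ≤ (Real.pi ^ n)⁻¹ * ((1 + ‖w‖) ^ (k + K) * Real.exp (-‖w‖ ^ 2)) := by
        gcongr
    _ ≤ _ := by
        exact mul_le_mul_of_nonneg_left (hexp _ (norm_nonneg w)) (by positivity)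

theorem integrable_one_add_norm_pow (k : ℕ) :
    Integrable (fun w : Fin n → ℂ => (1 + ‖w‖) ^ k) (stdComplexGaussian n) :=
  (integrable_stdComplexGaussian_iff _).2 (integrable_one_add_norm_pow_mul_gaussDensity k)

instance isProbabilityMeasure_stdComplexGaussian :
    IsProbabilityMeasure (stdComplexGaussian n) := by
  have hint : Integrable (fun _ : Fin n → ℂ => (1 : ℝ)) (stdComplexGaussian n) := by
    simpa using integrable_one_add_norm_pow (n := n) 0
  have hfin : IsFiniteMeasure (stdComplexGaussian n) := by
    simpa [integrable_const_iff] using hint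
  have h1 : ∫ _ : Fin n → ℂ, (1 : ℝ) ∂stdComplexGaussian n = 1 := by
    rw [integral_stdComplexGaussian]
    have h2 : ∀ w : Fin n → ℂ, 1 * gaussDensity n w =
        (Real.pi ^ n)⁻¹ * ∏ i, Real.exp (-1 * ‖w i‖ ^ 2) := fun w => by
      rw [← Real.exp_sum, gaussDensity]; simp
    simp_rw [h2]
    rw [integral_const_mul, integral_fintype_prod_volume_eq_prod
      (f := fun _ : Fin n => fun x : ℂ => Real.exp (-1 * ‖x‖ ^ 2))]
    rw [GaussianFourier.integral_rexp_neg_mul_sq_norm (by norm_num)]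
    simp [Real.pi_ne_zero]
  constructor
  rw [integral_const] at h1
  have h3 : ((stdComplexGaussian n).real Set.univ) = 1 := by simpa using h1
  rw [Measure.real, ENNReal.toReal_eq_one_iff] at h3
  exact h3

theorem integrable_of_hasTemperateGrowth {f : (Fin n → ℂ) → ℝ} (hf : HasTemperateGrowth f) :
    Integrable f (stdComplexGaussian n) := by
  obtain ⟨k, C, -, h⟩ := hf.exists_norm_le
  exact ((integrable_one_add_norm_pow k).const_mul C).mono'
    hf.1.continuous.aestronglyMeasurable (.of_forall h)

theorem integrable_prod_one_add_norm_pow (k : ℕ) :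
    Integrable (fun p : (Fin n → ℂ) × (Fin n → ℂ) => (1 + ‖p‖) ^ k)
      ((stdComplexGaussian n).prod (stdComplexGaussian n)) := by
  refine ((integrable_one_add_norm_pow k).mul_prod (integrable_one_add_norm_pow k)).mono'
    (by apply Continuous.aestronglyMeasurable; fun_prop) (.of_forall fun p => ?_)
  rw [Real.norm_of_nonneg (by positivity), ← mul_pow]
  gcongr
  have h1 := norm_nonneg p.1
  have h2 := norm_nonneg p.2
  rw [Prod.norm_def]
  rcases max_choice ‖p.1‖ ‖p.2‖ with h | h <;> rw [h] <;> nlinarith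

theorem integrable_prod_of_hasTemperateGrowth {f : (Fin n → ℂ) × (Fin n → ℂ) → ℝ}
    (hf : HasTemperateGrowth f) :
    Integrable f ((stdComplexGaussian n).prod (stdComplexGaussian n)) := by
  obtain ⟨k, C, -, h⟩ := hf.exists_norm_le
  exact ((integrable_prod_one_add_norm_pow k).const_mul C).mono'
    hf.1.continuous.aestronglyMeasurable (.of_forall h)

end Gaussian

/-! ### Real coordinates and integration by parts -/

section Basis

variable {n : ℕ}

/-- The standard real basis of `ℂⁿ`: the vectors `e_j` (second index `false`) and `i e_j`
(second index `true`). -/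
noncomputable def realBasis (a : Fin n × Bool) : Fin n → ℂ :=
  Pi.single a.1 (bif a.2 then Complex.I else 1)

/-- The real coordinates on `ℂⁿ` dual to `realBasis`. -/
noncomputable def realCoord (a : Fin n × Bool) : (Fin n → ℂ) →L[ℝ] ℝ :=
  (bif a.2 then Complex.imCLM else Complex.reCLM).comp (ContinuousLinearMap.proj a.1)

theorem sum_realCoord_smul_realBasis (z : Fin n → ℂ) :
    ∑ a, realCoord a z • realBasis a = z := by
  ext j
  rw [Fintype.sum_prod_type]
  simp only [Fintype.sum_bool, Finset.sum_apply, Pi.add_apply, Pi.smul_apply, realCoord, realBasis,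
    Pi.single_apply]
  rw [Finset.sum_eq_single j]
  · apply Complex.ext <;> simp
  · intro b _ hb
    simp [hb.symm]
  · simp

theorem dirDeriv_eq_sum {F : Type*} [NormedAddCommGroup F] [NormedSpace ℝ F]
    (f : (Fin n → ℂ) → F) (v z : Fin n → ℂ) :
    dirDeriv v f z = ∑ a, realCoord a v • dirDeriv (realBasis a) f z := by
  conv_lhs => rw [dirDeriv, ← sum_realCoord_smul_realBasis v, map_sum]
  simp [dirDeriv]

theorem realCoord_hasTemperateGrowth (a : Fin n × Bool) :
    HasTemperateGrowth (fun z => realCoord a z) :=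
  (realCoord a).hasTemperateGrowth

theorem hasFDerivAt_gaussDensity (w : Fin n → ℂ) :
    HasFDerivAt (gaussDensity n)
      ((-2 * gaussDensity n w) • ∑ i, (innerSL ℝ (w i)).comp (ContinuousLinearMap.proj i)) w := by
  have h1 : HasFDerivAt (fun w : Fin n → ℂ => ∑ i, ‖w i‖ ^ 2) _ w :=
    HasFDerivAt.fun_sum fun i (_ : i ∈ Finset.univ) =>
      (hasFDerivAt_apply (𝕜 := ℝ) i w).norm_sq
  have h2 : HasFDerivAt (gaussDensity n) _ w := (h1.neg.exp).const_mul ((Real.pi ^ n)⁻¹)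
  refine h2.congr_fderiv ?_
  rw [← Finset.smul_sum]
  ext v
  simp only [gaussDensity, Pi.neg_apply, smul_apply,
    neg_apply, smul_eq_mul]
  ring

theorem fderiv_gaussDensity_realBasis (a : Fin n × Bool) (w : Fin n → ℂ) :
    fderiv ℝ (gaussDensity n) w (realBasis a) = -2 * realCoord a w * gaussDensity n w := by
  rw [(hasFDerivAt_gaussDensity w).fderiv]
  obtain ⟨j, s⟩ := a
  have h3 : (∑ i, (innerSL ℝ (w i)).comp
      (ContinuousLinearMap.proj (R := ℝ) (φ := fun _ : Fin n => ℂ) i)) (realBasis (j, s)) =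
      realCoord (j, s) w := by
    rw [sum_apply, Finset.sum_eq_single j]
    · cases s <;> simp [realBasis, realCoord]
    · intro i _ hi
      simp [realBasis, hi]
    · simp
  rw [smul_apply, h3, smul_eq_mul]
  ring

/-- Gaussian integration by parts. The real coordinates have variance `1 / 2`. -/
theorem integral_realCoord_mul {u : (Fin n → ℂ) → ℝ} (hu : HasTemperateGrowth u)
    (a : Fin n × Bool) :
    ∫ w, realCoord a w * u w ∂stdComplexGaussian n =
      1 / 2 * ∫ w, dirDeriv (realBasis a) u w ∂stdComplexGaussian n := by
  have h := integral_mul_fderiv_eq_neg_fderiv_mul_of_integrable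
    (μ := (volume : Measure (Fin n → ℂ))) (f := u) (g := gaussDensity n) (v := realBasis a)
    ((integrable_stdComplexGaussian_iff _).1 (integrable_of_hasTemperateGrowth
      (hu.dirDeriv (realBasis a))))
    (by
      have := ((integrable_stdComplexGaussian_iff _).1 (integrable_of_hasTemperateGrowth
        ((realCoord_hasTemperateGrowth a).mul hu))).const_mul (-2)
      refine this.congr (.of_forall fun w => ?_)
      simp only [fderiv_gaussDensity_realBasis, Pi.mul_apply]
      ring)
    ((integrable_stdComplexGaussian_iff _).1 (integrable_of_hasTemperateGrowth hu))
    (fun w _ => hu.differentiableAt w) (fun w _ => (hasFDerivAt_gaussDensity w).differentiableAt)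
  rw [integral_stdComplexGaussian, integral_stdComplexGaussian]
  simp only [fderiv_gaussDensity_realBasis] at h
  have h1 : ∀ w, u w * (-2 * realCoord a w * gaussDensity n w) =
      -2 * (realCoord a w * u w * gaussDensity n w) := fun w => by ring
  simp_rw [h1] at h
  rw [integral_const_mul] at h
  simp only [dirDeriv]
  linarith

end Basis

/-! ### Interpolation between correlated and independent Gaussian vectors -/

section Interpolation

variable {n : ℕ}

/-- The linear map `(z, w) ↦ cos s • z + sin s • w`. It sends a pair of independent standard
complex Gaussian vectors to one whose correlation with `z` is `cos s`. -/
noncomputable def rotMap (n : ℕ) (s : ℝ) : (Fin n → ℂ) × (Fin n → ℂ) →L[ℝ] (Fin n → ℂ) :=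
  Real.cos s • ContinuousLinearMap.fst ℝ _ _ + Real.sin s • ContinuousLinearMap.snd ℝ _ _

theorem rotMap_apply (s : ℝ) (p : (Fin n → ℂ) × (Fin n → ℂ)) :
    rotMap n s p = Real.cos s • p.1 + Real.sin s • p.2 := by
  simp [rotMap]

/-- The integral of `f(Z) g(cos s Z + sin s W)` over independent standard complex Gaussian
vectors `Z` and `W`: it is `∫ f g` at `s = 0` and `(∫ f) (∫ g)` at `s = π / 2`. -/
noncomputable def interp (f g : (Fin n → ℂ) → ℝ) (s : ℝ) : ℝ :=
  ∫ p, f p.1 * g (rotMap n s p) ∂(stdComplexGaussian n).prod (stdComplexGaussian n)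

theorem hasTemperateGrowth_interp {f g : (Fin n → ℂ) → ℝ} (hf : HasTemperateGrowth f)
    (hg : HasTemperateGrowth g) (s : ℝ) :
    HasTemperateGrowth fun p : (Fin n → ℂ) × (Fin n → ℂ) => f p.1 * g (rotMap n s p) :=
  (hf.comp (ContinuousLinearMap.fst ℝ (Fin n → ℂ) (Fin n → ℂ)).hasTemperateGrowth).mul
    (hg.comp (rotMap n s).hasTemperateGrowth)

theorem integrable_interp {f g : (Fin n → ℂ) → ℝ} (hf : HasTemperateGrowth f)
    (hg : HasTemperateGrowth g) (s : ℝ) :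
    Integrable (fun p : (Fin n → ℂ) × (Fin n → ℂ) => f p.1 * g (rotMap n s p))
      ((stdComplexGaussian n).prod (stdComplexGaussian n)) :=
  integrable_prod_of_hasTemperateGrowth (hasTemperateGrowth_interp hf hg s)

theorem integrable_realCoord_fst_mul {U : (Fin n → ℂ) × (Fin n → ℂ) → ℝ}
    (hU : HasTemperateGrowth U) (a : Fin n × Bool) :
    Integrable (fun p => realCoord a p.1 * U p)
      ((stdComplexGaussian n).prod (stdComplexGaussian n)) :=
  integrable_prod_of_hasTemperateGrowth (((realCoord_hasTemperateGrowth a).comp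
    (ContinuousLinearMap.fst ℝ (Fin n → ℂ) (Fin n → ℂ)).hasTemperateGrowth).mul hU)

theorem integrable_realCoord_snd_mul {U : (Fin n → ℂ) × (Fin n → ℂ) → ℝ}
    (hU : HasTemperateGrowth U) (a : Fin n × Bool) :
    Integrable (fun p => realCoord a p.2 * U p)
      ((stdComplexGaussian n).prod (stdComplexGaussian n)) :=
  integrable_prod_of_hasTemperateGrowth (((realCoord_hasTemperateGrowth a).comp
    (ContinuousLinearMap.snd ℝ (Fin n → ℂ) (Fin n → ℂ)).hasTemperateGrowth).mul hU)

theorem integral_realCoord_fst_mul {U : (Fin n → ℂ) × (Fin n → ℂ) → ℝ}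
    (hU : HasTemperateGrowth U) (a : Fin n × Bool) :
    ∫ p, realCoord a p.1 * U p ∂(stdComplexGaussian n).prod (stdComplexGaussian n) =
      1 / 2 * ∫ p, dirDeriv (realBasis a, 0) U p
        ∂(stdComplexGaussian n).prod (stdComplexGaussian n) := by
  rw [integral_prod_symm _ (integrable_realCoord_fst_mul hU a),
    integral_prod_symm _ (integrable_prod_of_hasTemperateGrowth (hU.dirDeriv _)),
    ← integral_const_mul]
  refine integral_congr_ae (.of_forall fun y => ?_)
  have hs : HasTemperateGrowth fun x : Fin n → ℂ => (x, y) := by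
    convert (ContinuousLinearMap.inl ℝ (Fin n → ℂ) (Fin n → ℂ)).hasTemperateGrowth.add
      (HasTemperateGrowth.const ((0 : Fin n → ℂ), y)) using 1
    funext x
    simp
  have hd : ∀ x, dirDeriv (realBasis a) (fun x => U (x, y)) x =
      dirDeriv (realBasis a, 0) U (x, y) := fun x => by
    have := (hU.differentiableAt (x, y)).hasFDerivAt.comp
      (f := fun x => (x, y)) x (hasFDerivAt_prodMk_left x y)
    simp only [dirDeriv]
    rw [show (fun x => U (x, y)) = U ∘ fun x => (x, y) from rfl, this.fderiv]
    simp
  have := integral_realCoord_mul (hU.comp hs) a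
  simp only [comp_def] at this
  simp_rw [hd] at this
  exact this

theorem integral_realCoord_snd_mul {U : (Fin n → ℂ) × (Fin n → ℂ) → ℝ}
    (hU : HasTemperateGrowth U) (a : Fin n × Bool) :
    ∫ p, realCoord a p.2 * U p ∂(stdComplexGaussian n).prod (stdComplexGaussian n) =
      1 / 2 * ∫ p, dirDeriv (0, realBasis a) U p
        ∂(stdComplexGaussian n).prod (stdComplexGaussian n) := by
  rw [integral_prod _ (integrable_realCoord_snd_mul hU a),
    integral_prod _ (integrable_prod_of_hasTemperateGrowth (hU.dirDeriv _)),
    ← integral_const_mul]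
  refine integral_congr_ae (.of_forall fun x => ?_)
  have hs : HasTemperateGrowth fun y : Fin n → ℂ => (x, y) := by
    convert (ContinuousLinearMap.inr ℝ (Fin n → ℂ) (Fin n → ℂ)).hasTemperateGrowth.add
      (HasTemperateGrowth.const (x, (0 : Fin n → ℂ))) using 1
    funext y
    simp
  have hd : ∀ y, dirDeriv (realBasis a) (fun y => U (x, y)) y =
      dirDeriv (0, realBasis a) U (x, y) := fun y => by
    have := (hU.differentiableAt (x, y)).hasFDerivAt.comp
      (f := fun y => (x, y)) y (hasFDerivAt_prodMk_right x y)
    simp only [dirDeriv]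
    rw [show (fun y => U (x, y)) = U ∘ fun y => (x, y) from rfl, this.fderiv]
    simp
  have := integral_realCoord_mul (hU.comp hs) a
  simp only [comp_def] at this
  simp_rw [hd] at this
  exact this

theorem dirDeriv_interp {f g : (Fin n → ℂ) → ℝ} (hf : HasTemperateGrowth f)
    (hg : HasTemperateGrowth g) (s : ℝ) (v w : Fin n → ℂ) (p : (Fin n → ℂ) × (Fin n → ℂ)) :
    dirDeriv (v, w) (fun p : (Fin n → ℂ) × (Fin n → ℂ) => f p.1 * g (rotMap n s p)) p =
      dirDeriv v f p.1 * g (rotMap n s p) + Real.cos s * (f p.1 * dirDeriv v g (rotMap n s p)) +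
        Real.sin s * (f p.1 * dirDeriv w g (rotMap n s p)) := by
  have h1 : HasFDerivAt (fun p : (Fin n → ℂ) × (Fin n → ℂ) => f p.1) _ p :=
    (hf.differentiableAt p.1).hasFDerivAt.comp p hasFDerivAt_fst
  have h2 : HasFDerivAt (fun p : (Fin n → ℂ) × (Fin n → ℂ) => g (rotMap n s p)) _ p :=
    (hg.differentiableAt (rotMap n s p)).hasFDerivAt.comp p (rotMap n s).hasFDerivAt
  rw [dirDeriv_mul h1.differentiableAt h2.differentiableAt]
  simp only [dirDeriv, h1.fderiv, h2.fderiv]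
  simp only [ContinuousLinearMap.comp_apply, ContinuousLinearMap.coe_fst', rotMap_apply, map_add,
    map_smul, smul_eq_mul]
  ring

theorem integral_realCoord_fst_mul_interp {f g : (Fin n → ℂ) → ℝ} (hf : HasTemperateGrowth f)
    (hg : HasTemperateGrowth g) (s : ℝ) (a : Fin n × Bool) :
    ∫ p, realCoord a p.1 * (f p.1 * g (rotMap n s p))
        ∂(stdComplexGaussian n).prod (stdComplexGaussian n) =
      1 / 2 * (interp (dirDeriv (realBasis a) f) g s +
        Real.cos s * interp f (dirDeriv (realBasis a) g) s) := by
  rw [integral_realCoord_fst_mul (hasTemperateGrowth_interp hf hg s)]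
  simp_rw [dirDeriv_interp hf hg]
  have h0 : ∀ q : Fin n → ℂ, dirDeriv 0 g q = 0 := fun q => by simp [dirDeriv]
  simp only [h0, mul_zero, add_zero]
  rw [integral_add (integrable_interp (hf.dirDeriv _) hg s)
    ((integrable_interp hf (hg.dirDeriv _) s).const_mul _), integral_const_mul]
  rfl

theorem integral_realCoord_snd_mul_interp {f g : (Fin n → ℂ) → ℝ} (hf : HasTemperateGrowth f)
    (hg : HasTemperateGrowth g) (s : ℝ) (a : Fin n × Bool) :
    ∫ p, realCoord a p.2 * (f p.1 * g (rotMap n s p))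
        ∂(stdComplexGaussian n).prod (stdComplexGaussian n) =
      1 / 2 * (Real.sin s * interp f (dirDeriv (realBasis a) g) s) := by
  rw [integral_realCoord_snd_mul (hasTemperateGrowth_interp hf hg s)]
  simp_rw [dirDeriv_interp hf hg]
  have h0 : ∀ (h : (Fin n → ℂ) → ℝ) (q : Fin n → ℂ), dirDeriv 0 h q = 0 := fun h q => by
    simp [dirDeriv]
  simp only [h0, mul_zero, zero_mul, zero_add]
  rw [integral_const_mul]
  rfl

theorem norm_rotMap_le (s : ℝ) (p : (Fin n → ℂ) × (Fin n → ℂ)) : ‖rotMap n s p‖ ≤ 2 * ‖p‖ := by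
  rw [rotMap_apply]
  calc _ ≤ ‖Real.cos s • p.1‖ + ‖Real.sin s • p.2‖ := norm_add_le _ _
    _ ≤ 1 * ‖p‖ + 1 * ‖p‖ := by
      rw [norm_smul, norm_smul]
      gcongr
      · exact Real.abs_cos_le_one s
      · exact norm_fst_le p
      · exact Real.abs_sin_le_one s
      · exact norm_snd_le p
    _ = _ := by ring

/-- Differentiation in `s` shifts the angle by `π / 2`. -/
theorem hasDerivAt_rotMap (s : ℝ) (p : (Fin n → ℂ) × (Fin n → ℂ)) :
    HasDerivAt (fun s => rotMap n s p) (rotMap n (s + Real.pi / 2) p) s := by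
  simp only [rotMap_apply, Real.cos_add_pi_div_two, Real.sin_add_pi_div_two]
  exact ((Real.hasDerivAt_cos s).smul_const p.1).add ((Real.hasDerivAt_sin s).smul_const p.2)

theorem hasDerivAt_interp_fderiv {f g : (Fin n → ℂ) → ℝ} (hf : HasTemperateGrowth f)
    (hg : HasTemperateGrowth g) (s : ℝ) :
    HasDerivAt (interp f g)
      (∫ p, f p.1 * fderiv ℝ g (rotMap n s p) (rotMap n (s + Real.pi / 2) p)
        ∂(stdComplexGaussian n).prod (stdComplexGaussian n)) s := by
  obtain ⟨k, C, hC, hfb⟩ := hf.exists_norm_le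
  obtain ⟨l, D, hD, hgb⟩ := hg.fderiv.exists_norm_le
  have hcf := hf.1.continuous
  have hcg := hg.fderiv.1.continuous
  refine (hasDerivAt_integral_of_dominated_loc_of_deriv_le (s := Set.univ)
    (F := fun t p => f p.1 * g (rotMap n t p))
    (F' := fun t p => f p.1 * fderiv ℝ g (rotMap n t p) (rotMap n (t + Real.pi / 2) p))
    (bound := fun p => (C * D * 2 ^ (l + 1)) * (1 + ‖p‖) ^ (k + l + 1))
    Filter.univ_mem (.of_forall fun t => (integrable_interp hf hg t).1)
    (integrable_interp hf hg s) ?_ ?_ ?_ ?_).2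
  · apply Continuous.aestronglyMeasurable
    fun_prop
  · refine .of_forall fun p t _ => ?_
    have h1 : ‖p.1‖ ≤ ‖p‖ := norm_fst_le p
    have h2 := norm_rotMap_le t p
    have h3 := norm_rotMap_le (t + Real.pi / 2) p
    have h4 := norm_nonneg p
    calc _ ≤ ‖f p.1‖ * (‖fderiv ℝ g (rotMap n t p)‖ * ‖rotMap n (t + Real.pi / 2) p‖) := by
          rw [norm_mul]
          gcongr
          exact ContinuousLinearMap.le_opNorm _ _
      _ ≤ (C * (1 + ‖p‖) ^ k) * ((D * (2 * (1 + ‖p‖)) ^ l) * (2 * (1 + ‖p‖))) := by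
          gcongr
          · exact (hfb _).trans (by gcongr)
          · refine (hgb _).trans ?_
            gcongr
            linarith
          · linarith
      _ = _ := by rw [mul_pow]; ring
  · exact (integrable_prod_one_add_norm_pow _).const_mul _
  · refine .of_forall fun p t _ => ?_
    exact ((hg.differentiableAt _).hasFDerivAt.comp_hasDerivAt t
      (hasDerivAt_rotMap t p)).const_mul _

/-- The second order terms produced by the two integrations by parts cancel, because
`Z ↦ cos s Z + sin s W` and its derivative in `s` are uncorrelated. -/
theorem hasDerivAt_interp {f g : (Fin n → ℂ) → ℝ} (hf : HasTemperateGrowth f)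
    (hg : HasTemperateGrowth g) (s : ℝ) :
    HasDerivAt (interp f g)
      (-(1 / 2) * Real.sin s *
        ∑ a, interp (dirDeriv (realBasis a) f) (dirDeriv (realBasis a) g) s) s := by
  refine (hasDerivAt_interp_fderiv hf hg s).congr_deriv ?_
  have h1 : ∀ p : (Fin n → ℂ) × (Fin n → ℂ),
      f p.1 * fderiv ℝ g (rotMap n s p) (rotMap n (s + Real.pi / 2) p) =
      ∑ a, (-Real.sin s * (realCoord a p.1 * (f p.1 * dirDeriv (realBasis a) g (rotMap n s p))) +
        Real.cos s * (realCoord a p.2 * (f p.1 * dirDeriv (realBasis a) g (rotMap n s p)))) := by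
    intro p
    have h := dirDeriv_eq_sum g (rotMap n (s + Real.pi / 2) p) (rotMap n s p)
    rw [dirDeriv] at h
    rw [h, Finset.mul_sum]
    refine Finset.sum_congr rfl fun a _ => ?_
    rw [rotMap_apply (s + Real.pi / 2), map_add, map_smul, map_smul, Real.cos_add_pi_div_two,
      Real.sin_add_pi_div_two]
    simp only [smul_eq_mul]
    ring
  simp_rw [h1]
  have hi1 : ∀ a, Integrable (fun p : (Fin n → ℂ) × (Fin n → ℂ) =>
      -Real.sin s * (realCoord a p.1 * (f p.1 * dirDeriv (realBasis a) g (rotMap n s p))))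
      ((stdComplexGaussian n).prod (stdComplexGaussian n)) := fun a =>
    (integrable_realCoord_fst_mul (hasTemperateGrowth_interp hf (hg.dirDeriv _) s) a).const_mul _
  have hi2 : ∀ a, Integrable (fun p : (Fin n → ℂ) × (Fin n → ℂ) =>
      Real.cos s * (realCoord a p.2 * (f p.1 * dirDeriv (realBasis a) g (rotMap n s p))))
      ((stdComplexGaussian n).prod (stdComplexGaussian n)) := fun a =>
    (integrable_realCoord_snd_mul (hasTemperateGrowth_interp hf (hg.dirDeriv _) s) a).const_mul _
  have hi : ∀ a, Integrable (fun p : (Fin n → ℂ) × (Fin n → ℂ) =>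
      -Real.sin s * (realCoord a p.1 * (f p.1 * dirDeriv (realBasis a) g (rotMap n s p))) +
        Real.cos s * (realCoord a p.2 * (f p.1 * dirDeriv (realBasis a) g (rotMap n s p))))
      ((stdComplexGaussian n).prod (stdComplexGaussian n)) := fun a => (hi1 a).add (hi2 a)
  rw [integral_finsetSum _ fun a _ => hi a, Finset.mul_sum]
  refine Finset.sum_congr rfl fun a _ => ?_
  rw [integral_add (hi1 a) (hi2 a), integral_const_mul, integral_const_mul,
    integral_realCoord_fst_mul_interp hf (hg.dirDeriv _),
    integral_realCoord_snd_mul_interp hf (hg.dirDeriv _)]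
  ring

theorem interp_zero (f g : (Fin n → ℂ) → ℝ) :
    interp f g 0 = ∫ w, f w * g w ∂stdComplexGaussian n := by
  have := integral_fun_fst (μ := stdComplexGaussian n) (ν := stdComplexGaussian n)
    (fun w => f w * g w)
  simpa [interp, rotMap_apply] using this

theorem interp_pi_div_two (f g : (Fin n → ℂ) → ℝ) :
    interp f g (Real.pi / 2) =
      (∫ w, f w ∂stdComplexGaussian n) * ∫ w, g w ∂stdComplexGaussian n := by
  simpa [interp, rotMap_apply] using integral_prod_mul (μ := stdComplexGaussian n)
    (ν := stdComplexGaussian n) f g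

end Interpolation

/-! ### Levi forms -/

section ComplexStructure

variable {n : ℕ}

theorem I_smul_realBasis (a : Fin n × Bool) :
    Complex.I • realBasis a = (bif a.2 then (-1 : ℝ) else 1) • realBasis (a.1, !a.2) := by
  obtain ⟨j, s⟩ := a
  cases s <;> ext i <;> by_cases h : i = j <;> simp [realBasis, h]

/-- A symmetric form has trace zero against multiplication by `i`, which is antisymmetric. -/
theorem sum_apply_I_smul_realBasis (B : (Fin n → ℂ) →L[ℝ] (Fin n → ℂ) →L[ℝ] ℝ)
    (hB : ∀ u v, B u v = B v u) : ∑ a, B (realBasis a) (Complex.I • realBasis a) = 0 := by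
  simp only [I_smul_realBasis, map_smul]
  rw [Fintype.sum_prod_type]
  refine Finset.sum_eq_zero fun j _ => ?_
  simp [hB (realBasis (j, true))]

/-- Multiplication by `i` permutes `realBasis` up to signs, which cancel because each of the two
forms contributes the same sign. -/
theorem sum_mul_I_smul_realBasis (A C : (Fin n → ℂ) →L[ℝ] (Fin n → ℂ) →L[ℝ] ℝ)
    (hC : ∀ u v, C (Complex.I • u) (Complex.I • v) = C u v) :
    ∑ a, ∑ b, A (Complex.I • realBasis a) (Complex.I • realBasis b) *
        C (realBasis a) (realBasis b) =
      ∑ a, ∑ b, A (realBasis a) (realBasis b) * C (realBasis a) (realBasis b) := by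
  let σ : Fin n × Bool ≃ Fin n × Bool := (Equiv.refl _).prodCongr Equiv.boolNot
  have h : ∀ a b : Fin n × Bool, A (Complex.I • realBasis a) (Complex.I • realBasis b) *
      C (realBasis a) (realBasis b) =
      A (realBasis (σ a)) (realBasis (σ b)) * C (realBasis (σ a)) (realBasis (σ b)) := by
    intro a b
    rw [← hC]
    obtain ⟨i, s⟩ := a
    obtain ⟨j, t⟩ := b
    simp only [I_smul_realBasis, map_smul, smul_apply]
    cases s <;> cases t <;> simp [σ]
  simp_rw [h]
  rw [σ.sum_comp (fun a => ∑ b, A (realBasis a) (realBasis (σ b)) *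
    C (realBasis a) (realBasis (σ b)))]
  exact Finset.sum_congr rfl fun a _ =>
    σ.sum_comp (fun b => A (realBasis a) (realBasis b) * C (realBasis a) (realBasis b))

/-- Twice the `i`-invariant part of a real bilinear form; for a real Hessian this is the Levi form,
up to a factor. -/
noncomputable def leviForm (B : (Fin n → ℂ) →L[ℝ] (Fin n → ℂ) →L[ℝ] ℝ) :
    (Fin n → ℂ) →L[ℝ] (Fin n → ℂ) →L[ℝ] ℝ :=
  B + B.bilinearComp (Complex.I • ContinuousLinearMap.id ℝ (Fin n → ℂ))
    (Complex.I • ContinuousLinearMap.id ℝ (Fin n → ℂ))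

theorem leviForm_apply (B : (Fin n → ℂ) →L[ℝ] (Fin n → ℂ) →L[ℝ] ℝ) (u v : Fin n → ℂ) :
    leviForm B u v = B u v + B (Complex.I • u) (Complex.I • v) := by
  simp [leviForm]

theorem leviForm_I_smul (B : (Fin n → ℂ) →L[ℝ] (Fin n → ℂ) →L[ℝ] ℝ) (u v : Fin n → ℂ) :
    leviForm B (Complex.I • u) (Complex.I • v) = leviForm B u v := by
  simp [leviForm_apply, smul_smul, add_comm]

theorem posSemidef_of_bilin (B : (Fin n → ℂ) →L[ℝ] (Fin n → ℂ) →L[ℝ] ℝ)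
    (hB : ∀ u v, B u v = B v u) (hpos : ∀ v, 0 ≤ B v v) :
    (Matrix.of fun a b => B (realBasis a) (realBasis b)).PosSemidef := by
  refine Matrix.PosSemidef.of_dotProduct_mulVec_nonneg ?_ fun x => ?_
  · ext a b
    simp [hB (realBasis a)]
  · have h := hpos (∑ a, x a • realBasis a)
    simp only [map_sum, map_smul, sum_apply, smul_apply, smul_eq_mul] at h
    refine h.trans_eq ?_
    simp only [dotProduct, Matrix.mulVec, Matrix.of_apply, Pi.star_apply, star_trivial]
    simp_rw [Finset.mul_sum]
    rw [Finset.sum_comm]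
    refine Finset.sum_congr rfl fun a _ => Finset.sum_congr rfl fun b _ => ?_
    ring

/-- The trace of the product of two positive semidefinite Hermitian forms is nonnegative; the forms
are the `i`-invariant parts of `A` and `B`, and invariance of one factor suffices. -/
theorem sum_mul_leviForm_nonneg (A B : (Fin n → ℂ) →L[ℝ] (Fin n → ℂ) →L[ℝ] ℝ)
    (hA : ∀ u v, A u v = A v u) (hB : ∀ u v, B u v = B v u)
    (hApos : ∀ v, 0 ≤ leviForm A v v) (hBpos : ∀ v, 0 ≤ leviForm B v v) :
    0 ≤ ∑ a, ∑ b, A (realBasis a) (realBasis b) * leviForm B (realBasis a) (realBasis b) := by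
  have hsymm : ∀ {B : (Fin n → ℂ) →L[ℝ] (Fin n → ℂ) →L[ℝ] ℝ}, (∀ u v, B u v = B v u) →
      ∀ u v, leviForm B u v = leviForm B v u := fun h u v => by
    rw [leviForm_apply, leviForm_apply, h u, h (Complex.I • u)]
  have h := (((posSemidef_of_bilin _ (hsymm hA) hApos).hadamard
    (posSemidef_of_bilin _ (hsymm hB) hBpos)).dotProduct_mulVec_nonneg (fun _ => (1 : ℝ)))
  simp only [dotProduct, Matrix.mulVec, Matrix.hadamard_apply, Matrix.of_apply, Pi.star_apply,
    star_trivial, one_mul, mul_one] at h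
  have h2 : ∀ a b, leviForm A (realBasis a) (realBasis b) * leviForm B (realBasis a) (realBasis b) =
      A (realBasis a) (realBasis b) * leviForm B (realBasis a) (realBasis b) +
      A (Complex.I • realBasis a) (Complex.I • realBasis b) *
        leviForm B (realBasis a) (realBasis b) := fun a b => by
    rw [leviForm_apply A, add_mul]
  simp_rw [h2, Finset.sum_add_distrib] at h
  rw [sum_mul_I_smul_realBasis A _ (leviForm_I_smul B)] at h
  linarith

end ComplexStructure

/-! ### Correlation of plurisubharmonic functions -/

section Correlation

variable {n : ℕ}

/-- Plurisubharmonicity of a smooth function: the Laplacian along every complex line is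
nonnegative. -/
def IsPsh (f : (Fin n → ℂ) → ℝ) : Prop :=
  ∀ z v : Fin n → ℂ, 0 ≤ dirDeriv v (dirDeriv v f) z +
    dirDeriv (Complex.I • v) (dirDeriv (Complex.I • v) f) z

/-- Invariance under the circle action `w ↦ e^{iθ} w`. -/
def CircleInvariant (f : (Fin n → ℂ) → ℝ) : Prop :=
  ∀ (θ : ℝ) (w : Fin n → ℂ), f (Complex.exp (θ * Complex.I) • w) = f w

theorem fderiv_apply_I_smul_self {g : (Fin n → ℂ) → ℝ} (hg : HasTemperateGrowth g)
    (hc : CircleInvariant g) (w : Fin n → ℂ) : fderiv ℝ g w (Complex.I • w) = 0 := by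
  have h1 : HasDerivAt (fun θ : ℝ => Complex.exp (θ * Complex.I) • w) (Complex.I • w) 0 := by
    have h := ((Complex.ofRealCLM.hasDerivAt (x := (0 : ℝ))).mul_const Complex.I).cexp.smul_const w
    simpa using h
  have h2 : HasFDerivAt g (fderiv ℝ g w) (Complex.exp ((0 : ℝ) * Complex.I) • w) := by
    simpa using (hg.differentiableAt w).hasFDerivAt
  have h3 := h2.comp_hasDerivAt 0 h1
  have h4 : (g ∘ fun θ : ℝ => Complex.exp (θ * Complex.I) • w) = fun _ => g w :=
    funext fun θ => hc θ w
  rw [h4] at h3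
  exact h3.unique (hasDerivAt_const _ _)

/-- Differentiating the Euler relation of a circle invariant function expresses its first
derivatives through its second derivatives. -/
theorem CircleInvariant.dirDeriv_eq_sum {g : (Fin n → ℂ) → ℝ} (hg : HasTemperateGrowth g)
    (hc : CircleInvariant g) (v w : Fin n → ℂ) :
    dirDeriv v g w = ∑ b, realCoord b w *
      dirDeriv (Complex.I • realBasis b) (dirDeriv (Complex.I • v) g) w := by
  let J : (Fin n → ℂ) →L[ℝ] (Fin n → ℂ) := Complex.I • ContinuousLinearMap.id ℝ (Fin n → ℂ)
  have hJ : ∀ u, J u = Complex.I • u := fun u => by simp [J]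
  have h1 := (hg.fderiv.differentiableAt w).hasFDerivAt.clm_apply (J.hasFDerivAt (x := w))
  have h2 : (fun y => fderiv ℝ g y (J y)) = fun _ => 0 :=
    funext fun y => by rw [hJ, fderiv_apply_I_smul_self hg hc]
  rw [h2] at h1
  have h3 := congrArg (fun T => T (Complex.I • v)) (h1.unique (hasFDerivAt_const 0 w))
  simp only [add_apply, ContinuousLinearMap.comp_apply, ContinuousLinearMap.flip_apply, hJ,
    zero_apply, smul_smul, Complex.I_mul_I, neg_smul, one_smul, map_neg] at h3
  have h4 := (hg.1.contDiffAt (x := w)).isSymmSndFDerivAt (by simpa using ENat.LEInfty.out)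
    (Complex.I • v) (Complex.I • w)
  have h5 : Complex.I • w = ∑ b, realCoord b w • (Complex.I • realBasis b) := by
    conv_lhs => rw [← sum_realCoord_smul_realBasis w, Finset.smul_sum]
    exact Finset.sum_congr rfl fun b _ => smul_comm _ _ _
  have h6 : fderiv ℝ (fderiv ℝ g) w (Complex.I • w) (Complex.I • v) =
      ∑ b, realCoord b w * fderiv ℝ (fderiv ℝ g) w (Complex.I • realBasis b) (Complex.I • v) := by
    conv_lhs => rw [h5]
    simp
  simp_rw [dirDeriv_dirDeriv hg]
  rw [← h6, ← h4, dirDeriv]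
  linarith

/-- With the Euler relation of `g` the first-order sum becomes a second-order one. The terms in
which both derivatives produced by the integration by parts fall on `g` add up to zero, by
`sum_apply_I_smul_realBasis`. -/
theorem sum_interp_dirDeriv {f g : (Fin n → ℂ) → ℝ} (hf : HasTemperateGrowth f)
    (hg : HasTemperateGrowth g) (hc : CircleInvariant g) (s : ℝ) :
    ∑ a, interp (dirDeriv (realBasis a) f) (dirDeriv (realBasis a) g) s =
      1 / 2 * Real.cos s * ∑ a, ∑ b,
        interp (dirDeriv (realBasis b) (dirDeriv (realBasis a) f))
          (dirDeriv (Complex.I • realBasis b) (dirDeriv (Complex.I • realBasis a) g)) s := by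
  rw [Finset.mul_sum]
  refine Finset.sum_congr rfl fun a _ => ?_
  set F := dirDeriv (realBasis a) f
  have hF : HasTemperateGrowth F := hf.dirDeriv _
  set G := dirDeriv (Complex.I • realBasis a) g
  have hG : HasTemperateGrowth G := hg.dirDeriv _
  have hi : ∀ b, Integrable (fun p : (Fin n → ℂ) × (Fin n → ℂ) =>
      Real.cos s * (realCoord b p.1 *
        (F p.1 * dirDeriv (Complex.I • realBasis b) G (rotMap n s p))) +
      Real.sin s * (realCoord b p.2 *
        (F p.1 * dirDeriv (Complex.I • realBasis b) G (rotMap n s p))))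
      ((stdComplexGaussian n).prod (stdComplexGaussian n)) := fun b =>
    ((integrable_realCoord_fst_mul (hasTemperateGrowth_interp hF (hG.dirDeriv _) s)
      b).const_mul _).add ((integrable_realCoord_snd_mul (hasTemperateGrowth_interp hF
      (hG.dirDeriv _) s) b).const_mul _)
  have h1 : interp F (dirDeriv (realBasis a) g) s = ∑ b, (1 / 2 * Real.cos s *
      interp (dirDeriv (realBasis b) F) (dirDeriv (Complex.I • realBasis b) G) s +
      1 / 2 * interp F (dirDeriv (realBasis b) (dirDeriv (Complex.I • realBasis b) G)) s) := by
    have h2 : ∀ p : (Fin n → ℂ) × (Fin n → ℂ), F p.1 * dirDeriv (realBasis a) g (rotMap n s p) =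
        ∑ b, (Real.cos s * (realCoord b p.1 *
          (F p.1 * dirDeriv (Complex.I • realBasis b) G (rotMap n s p))) +
        Real.sin s * (realCoord b p.2 *
          (F p.1 * dirDeriv (Complex.I • realBasis b) G (rotMap n s p)))) := fun p => by
      rw [hc.dirDeriv_eq_sum hg, Finset.mul_sum]
      refine Finset.sum_congr rfl fun b _ => ?_
      have h3 : realCoord b (rotMap n s p) =
          Real.cos s * realCoord b p.1 + Real.sin s * realCoord b p.2 := by
        simp [rotMap_apply]
      rw [h3]
      ring
    rw [interp]
    simp_rw [h2]
    rw [integral_finsetSum _ fun b _ => hi b]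
    refine Finset.sum_congr rfl fun b _ => ?_
    rw [integral_add ((integrable_realCoord_fst_mul (hasTemperateGrowth_interp hF (hG.dirDeriv _) s)
        b).const_mul _) ((integrable_realCoord_snd_mul (hasTemperateGrowth_interp hF
        (hG.dirDeriv _) s) b).const_mul _), integral_const_mul, integral_const_mul,
      integral_realCoord_fst_mul_interp hF (hG.dirDeriv _),
      integral_realCoord_snd_mul_interp hF (hG.dirDeriv _)]
    linear_combination (1 / 2 * interp F
      (dirDeriv (realBasis b) (dirDeriv (Complex.I • realBasis b) G)) s) *
        (Real.sin_sq_add_cos_sq s)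
  have h4 : ∑ b, interp F
      (dirDeriv (realBasis b) (dirDeriv (Complex.I • realBasis b) G)) s = 0 := by
    simp only [interp]
    rw [← integral_finsetSum _ fun b _ => integrable_interp hF ((hG.dirDeriv _).dirDeriv _) s]
    refine integral_eq_zero_of_ae (.of_forall fun p => ?_)
    simp only [Pi.zero_apply]
    rw [← Finset.mul_sum]
    simp_rw [dirDeriv_dirDeriv hG]
    rw [sum_apply_I_smul_realBasis _ fun u v =>
      (hG.1.contDiffAt (x := _)).isSymmSndFDerivAt (by simpa using ENat.LEInfty.out) u v, mul_zero]
  rw [h1, Finset.sum_add_distrib, ← Finset.mul_sum, ← Finset.mul_sum, h4, mul_zero, add_zero]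

/-- Correlation inequality for smooth plurisubharmonic functions, one of them circle invariant. -/
theorem IsPsh.integral_mul_le {f g : (Fin n → ℂ) → ℝ} (hf : HasTemperateGrowth f)
    (hg : HasTemperateGrowth g) (hc : CircleInvariant g) (hfp : IsPsh f) (hgp : IsPsh g) :
    (∫ w, f w ∂stdComplexGaussian n) * (∫ w, g w ∂stdComplexGaussian n) ≤
      ∫ w, f w * g w ∂stdComplexGaussian n := by
  set Ψ : ℝ → ℝ := fun s => ∑ a, interp (dirDeriv (realBasis a) f) (dirDeriv (realBasis a) g) s
    with hΨ
  set R : ℝ → ℝ := fun s => ∑ a, ∑ b, interp (dirDeriv (realBasis b) (dirDeriv (realBasis a) f))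
    (dirDeriv (realBasis b) (dirDeriv (realBasis a) g)) s with hR
  set T : ℝ → ℝ := fun s => ∑ a, ∑ b, interp (dirDeriv (realBasis b) (dirDeriv (realBasis a) f))
    (dirDeriv (Complex.I • realBasis b) (dirDeriv (Complex.I • realBasis a) g)) s with hT
  have hΦ : ∀ s, HasDerivAt (interp f g) (-(1 / 2) * Real.sin s * Ψ s) s := hasDerivAt_interp hf hg
  have hΨ' : ∀ s, HasDerivAt Ψ (-(1 / 2) * Real.sin s * R s) s := fun s => by
    refine (HasDerivAt.fun_sum fun a _ => hasDerivAt_interp (hf.dirDeriv (realBasis a))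
      (hg.dirDeriv (realBasis a)) s).congr_deriv ?_
    rw [hR, Finset.mul_sum]
  have hΨT : ∀ s, Ψ s = 1 / 2 * Real.cos s * T s := sum_interp_dirDeriv hf hg hc
  have hcos : ∀ s, HasDerivAt (fun s => Real.cos s * Ψ s)
      (-(1 / 2) * Real.sin s * Real.cos s * (R s + T s)) s := fun s => by
    refine ((Real.hasDerivAt_cos s).mul (hΨ' s)).congr_deriv ?_
    rw [hΨT]
    ring
  have hRT : ∀ s, 0 ≤ R s + T s := fun s => by
    have : R s + T s = ∫ p, ∑ a, ∑ b,
        (dirDeriv (realBasis b) (dirDeriv (realBasis a) f) p.1 *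
          dirDeriv (realBasis b) (dirDeriv (realBasis a) g) (rotMap n s p) +
        dirDeriv (realBasis b) (dirDeriv (realBasis a) f) p.1 *
          dirDeriv (Complex.I • realBasis b) (dirDeriv (Complex.I • realBasis a) g) (rotMap n s p))
        ∂(stdComplexGaussian n).prod (stdComplexGaussian n) := by
      have h1 : ∀ a b, Integrable (fun p : (Fin n → ℂ) × (Fin n → ℂ) =>
          dirDeriv (realBasis b) (dirDeriv (realBasis a) f) p.1 *
          dirDeriv (realBasis b) (dirDeriv (realBasis a) g) (rotMap n s p))
          ((stdComplexGaussian n).prod (stdComplexGaussian n)) := fun a b =>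
        integrable_interp ((hf.dirDeriv _).dirDeriv _) ((hg.dirDeriv _).dirDeriv _) s
      have h2 : ∀ a b, Integrable (fun p : (Fin n → ℂ) × (Fin n → ℂ) =>
          dirDeriv (realBasis b) (dirDeriv (realBasis a) f) p.1 *
          dirDeriv (Complex.I • realBasis b) (dirDeriv (Complex.I • realBasis a) g) (rotMap n s p))
          ((stdComplexGaussian n).prod (stdComplexGaussian n)) := fun a b =>
        integrable_interp ((hf.dirDeriv _).dirDeriv _) ((hg.dirDeriv _).dirDeriv _) s
      have h3 : ∀ a b, Integrable (fun p : (Fin n → ℂ) × (Fin n → ℂ) =>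
          dirDeriv (realBasis b) (dirDeriv (realBasis a) f) p.1 *
          dirDeriv (realBasis b) (dirDeriv (realBasis a) g) (rotMap n s p) +
          dirDeriv (realBasis b) (dirDeriv (realBasis a) f) p.1 *
          dirDeriv (Complex.I • realBasis b) (dirDeriv (Complex.I • realBasis a) g) (rotMap n s p))
          ((stdComplexGaussian n).prod (stdComplexGaussian n)) := fun a b => (h1 a b).add (h2 a b)
      rw [integral_finsetSum _ fun a _ => integrable_finsetSum _ fun b _ => h3 a b, hR, hT]
      simp only [← Finset.sum_add_distrib]
      refine Finset.sum_congr rfl fun a _ => ?_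
      rw [integral_finsetSum _ fun b _ => h3 a b]
      refine Finset.sum_congr rfl fun b _ => ?_
      exact (integral_add (h1 a b) (h2 a b)).symm
    rw [this]
    refine integral_nonneg fun p => ?_
    -- The sum is the trace pairing of the Hessian of `f` with the Levi form of `g`.
    have key := sum_mul_leviForm_nonneg (fderiv ℝ (fderiv ℝ f) p.1)
      (fderiv ℝ (fderiv ℝ g) (rotMap n s p))
      (fun u v => (hf.1.contDiffAt (x := _)).isSymmSndFDerivAt
        (by simpa using ENat.LEInfty.out) u v)
      (fun u v => (hg.1.contDiffAt (x := _)).isSymmSndFDerivAt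
        (by simpa using ENat.LEInfty.out) u v)
      (fun v => by simpa [leviForm_apply, dirDeriv_dirDeriv hf] using hfp p.1 v)
      (fun v => by simpa [leviForm_apply, dirDeriv_dirDeriv hg] using hgp (rotMap n s p) v)
    simp only [Pi.zero_apply, dirDeriv_dirDeriv hf, dirDeriv_dirDeriv hg, ← mul_add,
      ← leviForm_apply]
    rw [Finset.sum_comm]
    exact key
  -- `cos s * Ψ s` decreases to its value `0` at `π / 2`, so `Ψ` is nonnegative.
  have hanti : AntitoneOn (fun s => Real.cos s * Ψ s) (Set.Icc 0 (Real.pi / 2)) := by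
    refine antitoneOn_of_hasDerivWithinAt_nonpos (convex_Icc _ _)
      (fun s _ => (hcos s).continuousAt.continuousWithinAt)
      (fun s _ => (hcos s).hasDerivWithinAt) fun s hs => ?_
    rw [interior_Icc] at hs
    have h1 := Real.sin_nonneg_of_nonneg_of_le_pi hs.1.le (by linarith [hs.2, Real.pi_pos])
    have h2 := Real.cos_nonneg_of_neg_pi_div_two_le_of_le (by linarith [hs.1, Real.pi_pos]) hs.2.le
    have := mul_nonneg (mul_nonneg h1 h2) (hRT s)
    linarith
  have hΨnonneg : ∀ s ∈ Set.Ioo 0 (Real.pi / 2), 0 ≤ Ψ s := fun s hs => by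
    have h1 := hanti (Set.Ioo_subset_Icc_self hs) (Set.right_mem_Icc.2 (by positivity)) hs.2.le
    simp only [Real.cos_pi_div_two, zero_mul] at h1
    exact nonneg_of_mul_nonneg_right h1
      (Real.cos_pos_of_mem_Ioo ⟨by linarith [hs.1, Real.pi_pos], hs.2⟩)
  have hfin : AntitoneOn (interp f g) (Set.Icc 0 (Real.pi / 2)) := by
    refine antitoneOn_of_hasDerivWithinAt_nonpos (convex_Icc _ _)
      (fun s _ => (hΦ s).continuousAt.continuousWithinAt)
      (fun s _ => (hΦ s).hasDerivWithinAt) fun s hs => ?_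
    rw [interior_Icc] at hs
    have h1 := Real.sin_nonneg_of_nonneg_of_le_pi hs.1.le (by linarith [hs.2, Real.pi_pos])
    have := mul_nonneg h1 (hΨnonneg s hs)
    linarith
  have h := hfin (Set.left_mem_Icc.2 (by positivity)) (Set.right_mem_Icc.2 (by positivity))
    (by positivity : (0 : ℝ) ≤ Real.pi / 2)
  rwa [interp_zero, interp_pi_div_two] at h

end Correlation

/-! ### Logarithmically plurisubharmonic functions -/

section LogPsh

variable {n : ℕ}

/-- Positivity of `f` and plurisubharmonicity of `log f`, for smooth `f`: along every complex line
the Laplacian of `log f` is nonnegative, which reads `|∇f|² ≤ f Δf`. -/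
def IsLogPsh (f : (Fin n → ℂ) → ℝ) : Prop :=
  (∀ z, 0 < f z) ∧ ∀ z v : Fin n → ℂ,
    dirDeriv v f z ^ 2 + dirDeriv (Complex.I • v) f z ^ 2 ≤
      f z * (dirDeriv v (dirDeriv v f) z + dirDeriv (Complex.I • v) (dirDeriv (Complex.I • v) f) z)

theorem IsLogPsh.isPsh {f : (Fin n → ℂ) → ℝ} (hf : IsLogPsh f) : IsPsh f := fun z v =>
  nonneg_of_mul_nonneg_right ((add_nonneg (sq_nonneg _) (sq_nonneg _)).trans (hf.2 z v)) (hf.1 z)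

theorem dirDeriv_dirDeriv_mul {f g : (Fin n → ℂ) → ℝ} (hf : HasTemperateGrowth f)
    (hg : HasTemperateGrowth g) (v z : Fin n → ℂ) :
    dirDeriv v (dirDeriv v fun x => f x * g x) z =
      dirDeriv v (dirDeriv v f) z * g z + 2 * (dirDeriv v f z * dirDeriv v g z) +
        f z * dirDeriv v (dirDeriv v g) z := by
  have h : dirDeriv v (fun x => f x * g x) = fun x => dirDeriv v f x * g x + f x * dirDeriv v g x :=
    funext fun x => dirDeriv_mul (hf.differentiableAt x) (hg.differentiableAt x) v
  have h1 := ((hf.dirDeriv v).differentiableAt z).mul (hg.differentiableAt z)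
  have h2 := (hf.differentiableAt z).mul ((hg.dirDeriv v).differentiableAt z)
  rw [h]
  have h3 : dirDeriv v (fun x => dirDeriv v f x * g x + f x * dirDeriv v g x) z =
      dirDeriv v (fun x => dirDeriv v f x * g x) z +
        dirDeriv v (fun x => f x * dirDeriv v g x) z := by
    have h4 := fderiv_fun_add h1 h2
    exact congrArg (fun T => T v) h4
  rw [h3, dirDeriv_mul ((hf.dirDeriv v).differentiableAt z) (hg.differentiableAt z),
    dirDeriv_mul (hf.differentiableAt z) ((hg.dirDeriv v).differentiableAt z)]
  ring

theorem IsLogPsh.mul {f g : (Fin n → ℂ) → ℝ} (hf : HasTemperateGrowth f)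
    (hg : HasTemperateGrowth g) (hfp : IsLogPsh f) (hgp : IsLogPsh g) :
    IsLogPsh fun z => f z * g z := by
  refine ⟨fun z => mul_pos (hfp.1 z) (hgp.1 z), fun z v => ?_⟩
  simp only [dirDeriv_dirDeriv_mul hf hg, dirDeriv_mul (hf.differentiableAt z)
    (hg.differentiableAt z)]
  have h1 := mul_le_mul_of_nonneg_left (hfp.2 z v) (sq_nonneg (g z))
  have h2 := mul_le_mul_of_nonneg_left (hgp.2 z v) (sq_nonneg (f z))
  linarith

theorem IsLogPsh.prod {ι : Type*} {f : ι → (Fin n → ℂ) → ℝ} {S : Finset ι}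
    (hf : ∀ i ∈ S, HasTemperateGrowth (f i)) (hfp : ∀ i ∈ S, IsLogPsh (f i)) :
    IsLogPsh fun z => ∏ i ∈ S, f i z := by
  classical
  induction S using Finset.induction_on with
  | empty =>
    have h : ∀ v : Fin n → ℂ, dirDeriv v (fun _ : Fin n → ℂ => (1 : ℝ)) = fun _ => 0 := fun v => by
      ext z; simp [dirDeriv]
    refine ⟨fun z => by simp, fun z v => ?_⟩
    simp only [Finset.prod_empty, h]
    simp [dirDeriv]
  | insert i S hi ih =>
    simp only [Finset.prod_insert hi]
    exact IsLogPsh.mul (hf i (by simp)) (HasTemperateGrowth.prod fun j hj => hf j (by simp [hj]))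
      (hfp i (by simp)) (ih (fun j hj => hf j (by simp [hj])) fun j hj => hfp j (by simp [hj]))

/-- Since `Δ log (q ^ a) = a Δ log q`. -/
theorem IsLogPsh.rpow {q : (Fin n → ℂ) → ℝ} (hq : HasTemperateGrowth q) (hqp : IsLogPsh q)
    {a : ℝ} (ha : 0 ≤ a) : IsLogPsh fun z => q z ^ a := by
  have hd : ∀ (b : ℝ) (v : Fin n → ℂ),
      dirDeriv v (fun z => q z ^ b) = fun z => b * q z ^ (b - 1) * dirDeriv v q z := fun b v => by
    ext z
    have h := (hq.differentiableAt z).hasFDerivAt.rpow_const (p := b) (.inl (hqp.1 z).ne')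
    rw [dirDeriv, h.fderiv]
    simp [dirDeriv]
  have hdiff : ∀ (b : ℝ) (z : Fin n → ℂ), DifferentiableAt ℝ (fun z => q z ^ b) z := fun b z =>
    ((hq.differentiableAt z).hasFDerivAt.rpow_const (p := b)
      (.inl (hqp.1 z).ne')).differentiableAt
  have hdd : ∀ v z : Fin n → ℂ, dirDeriv v (dirDeriv v fun z => q z ^ a) z =
      a * ((a - 1) * q z ^ (a - 1 - 1) * dirDeriv v q z ^ 2 +
        q z ^ (a - 1) * dirDeriv v (dirDeriv v q) z) := fun v z => by
    rw [hd a v, dirDeriv_mul ((hdiff (a - 1) z).const_mul a)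
      ((hq.dirDeriv v).differentiableAt z),
      dirDeriv_mul (differentiableAt_const a) (hdiff (a - 1) z), hd (a - 1) v]
    simp only [dirDeriv, fderiv_fun_const, Pi.zero_apply, zero_apply]
    ring
  refine ⟨fun z => Real.rpow_pos_of_pos (hqp.1 z) a, fun z v => ?_⟩
  have h0 := hqp.1 z
  simp only [hdd]
  simp only [hd, Real.rpow_sub_one h0.ne']
  have hP : 0 ≤ a * (q z ^ a / q z) ^ 2 := by positivity
  have h1 := mul_le_mul_of_nonneg_left (hqp.2 z v) hP
  have h2 : q z ^ a * (a * ((a - 1) * (q z ^ a / q z / q z) * dirDeriv v q z ^ 2 +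
      q z ^ a / q z * dirDeriv v (dirDeriv v q) z) +
      a * ((a - 1) * (q z ^ a / q z / q z) * dirDeriv (Complex.I • v) q z ^ 2 +
      q z ^ a / q z * dirDeriv (Complex.I • v) (dirDeriv (Complex.I • v) q) z)) =
      a * (q z ^ a / q z) ^ 2 * ((a - 1) * (dirDeriv v q z ^ 2 +
        dirDeriv (Complex.I • v) q z ^ 2) + q z * (dirDeriv v (dirDeriv v q) z +
        dirDeriv (Complex.I • v) (dirDeriv (Complex.I • v) q) z)) := by
    field_simp
    ring
  rw [h2]
  linarith

theorem dirDeriv_I_smul {F : (Fin n → ℂ) → ℂ} (hF : Differentiable ℂ F) (v z : Fin n → ℂ) :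
    dirDeriv (Complex.I • v) F z = Complex.I * dirDeriv v F z := by
  have h := ((hF z).hasFDerivAt.restrictScalars ℝ).fderiv
  simp only [dirDeriv, h]
  simp

/-- Holomorphic functions are harmonic along every complex line. -/
theorem dirDeriv_I_smul_dirDeriv_I_smul {F : (Fin n → ℂ) → ℂ} (hF : ContDiff ℂ 2 F)
    (v z : Fin n → ℂ) :
    dirDeriv (Complex.I • v) (dirDeriv (Complex.I • v) F) z = -dirDeriv v (dirDeriv v F) z := by
  have h1 : Differentiable ℂ F := hF.differentiable (by norm_num)
  have h2 : dirDeriv v F = fun z => fderiv ℂ F z v := by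
    ext z
    rw [dirDeriv, ((h1 z).hasFDerivAt.restrictScalars ℝ).fderiv]
    rfl
  have h3 : Differentiable ℂ (dirDeriv v F) := by
    rw [h2]
    exact ((hF.fderiv_right (m := 1) (by norm_num)).clm_apply contDiff_const).differentiable
      (by norm_num)
  have h4 : dirDeriv (Complex.I • v) F = fun z => Complex.I * dirDeriv v F z :=
    funext fun z => dirDeriv_I_smul h1 v z
  have h5 : Differentiable ℂ fun z => Complex.I * dirDeriv v F z := h3.const_mul _
  rw [h4, dirDeriv_I_smul h5, dirDeriv,
    (((h3 z).const_mul Complex.I).hasFDerivAt.restrictScalars ℝ).fderiv, fderiv_const_mul (h3 z)]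
  rw [dirDeriv, ((h3 z).hasFDerivAt.restrictScalars ℝ).fderiv]
  simp [← mul_assoc]

/-- For holomorphic `F`, along a complex line, `|∇|F|²|² = |F|² Δ|F|²`, and `Δ|F|² ≥ 0`. -/
theorem isLogPsh_norm_sq_add {F : (Fin n → ℂ) → ℂ} (hF : HasTemperateGrowth F)
    (hFc : ContDiff ℂ 2 F) {ε : ℝ} (hε : 0 < ε) : IsLogPsh fun z => ‖F z‖ ^ 2 + ε := by
  refine ⟨fun z => by positivity, fun z v => ?_⟩
  have hd : ∀ v : Fin n → ℂ, dirDeriv v (fun z => ‖F z‖ ^ 2 + ε) =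
      fun z => 2 * inner ℝ (F z) (dirDeriv v F z) := fun v => by
    ext z
    have h := ((hF.differentiableAt z).hasFDerivAt.norm_sq).add_const ε
    rw [dirDeriv, h.fderiv]
    simp [dirDeriv]
    ring
  have hdd : ∀ v : Fin n → ℂ, dirDeriv v (dirDeriv v fun z => ‖F z‖ ^ 2 + ε) z =
      2 * (inner ℝ (F z) (dirDeriv v (dirDeriv v F) z) + ‖dirDeriv v F z‖ ^ 2) := fun v => by
    have h1 := hF.differentiableAt z
    have h2 := (hF.dirDeriv v).differentiableAt z
    rw [hd, dirDeriv, fderiv_const_mul (h1.inner ℝ h2), smul_apply,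
      fderiv_inner_apply ℝ h1 h2, ← real_inner_self_eq_norm_sq]
    rfl
  simp only [hdd]
  simp only [hd, dirDeriv_I_smul_dirDeriv_I_smul hFc,
    dirDeriv_I_smul (hFc.differentiable (by norm_num))]
  generalize dirDeriv v (dirDeriv v F) z = c
  generalize dirDeriv v F z = b
  generalize F z = a
  have e : ∀ x : ℂ, ‖x‖ ^ 2 = x.re ^ 2 + x.im ^ 2 := fun x => by
    rw [← Complex.normSq_eq_norm_sq, Complex.normSq_apply]; ring
  simp only [e, Complex.inner, Complex.mul_re, Complex.mul_im, Complex.conj_re, Complex.conj_im,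
    Complex.I_re, Complex.I_im, Complex.neg_re, Complex.neg_im]
  nlinarith [mul_nonneg hε.le (add_nonneg (sq_nonneg b.re) (sq_nonneg b.im))]

end LogPsh

/-! ### Polynomials -/

section Polynomials

variable {n : ℕ}

theorem contDiff_eval (p : MvPolynomial (Fin n) ℂ) (m : WithTop ℕ∞) :
    ContDiff ℂ m fun z => MvPolynomial.eval z p := by
  induction p using MvPolynomial.induction_on with
  | C a => simpa using contDiff_const
  | add p q hp hq => simpa using hp.add hq
  | mul_X p i hp => simpa using hp.mul (contDiff_apply ℂ ℂ i)

theorem hasTemperateGrowth_eval (p : MvPolynomial (Fin n) ℂ) :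
    HasTemperateGrowth fun z => MvPolynomial.eval z p := by
  induction p using MvPolynomial.induction_on with
  | C a => simp
  | add p q hp hq =>
    simp only [map_add]
    exact hp.add hq
  | mul_X p i hp =>
    simp only [map_mul, MvPolynomial.eval_X]
    exact hp.mul (ContinuousLinearMap.proj (R := ℝ) (φ := fun _ : Fin n => ℂ)
      i).hasTemperateGrowth

theorem eval_smul_of_isHomogeneous {p : MvPolynomial (Fin n) ℂ} {d : ℕ} (hp : p.IsHomogeneous d)
    (c : ℂ) (w : Fin n → ℂ) :
    MvPolynomial.eval (c • w) p = c ^ d * MvPolynomial.eval w p := by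
  rw [MvPolynomial.eval_eq', MvPolynomial.eval_eq', Finset.mul_sum]
  refine Finset.sum_congr rfl fun m hm => ?_
  have hd : ∑ i, m i = d := by
    rw [← Finsupp.degree_eq_sum]
    by_contra h
    exact (MvPolynomial.mem_support_iff.1 hm) (hp.coeff_eq_zero h)
  simp only [Pi.smul_apply, smul_eq_mul, mul_pow, Finset.prod_mul_distrib]
  rw [Finset.prod_pow_eq_pow_sum, hd]
  ring

/-- Rescaling `F` by `ε ^ (-1 / 2)` reduces this to the temperate growth of `(1 + |z|²) ^ a`. -/
theorem hasTemperateGrowth_norm_sq_add_rpow {F : (Fin n → ℂ) → ℂ} (hF : HasTemperateGrowth F)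
    {ε : ℝ} (hε : 0 < ε) (a : ℝ) : HasTemperateGrowth fun z => (‖F z‖ ^ 2 + ε) ^ a := by
  have h1 : HasTemperateGrowth fun z => (((Real.sqrt ε)⁻¹ : ℝ) : ℂ) * F z :=
    (HasTemperateGrowth.const _).mul hF
  have h2 := (HasTemperateGrowth.const (E := Fin n → ℂ) (ε ^ a)).mul
    ((hasTemperateGrowth_one_add_norm_sq_rpow ℂ a).comp h1)
  have h3 : (fun z => (‖F z‖ ^ 2 + ε) ^ a) = fun z =>
      ε ^ a * (1 + ‖(((Real.sqrt ε)⁻¹ : ℝ) : ℂ) * F z‖ ^ 2) ^ a := by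
    funext z
    rw [← Real.mul_rpow hε.le (by positivity)]
    congr 1
    rw [norm_mul, Complex.norm_real, mul_pow, norm_inv, inv_pow,
      Real.norm_of_nonneg (Real.sqrt_nonneg _), Real.sq_sqrt hε.le]
    field_simp
    ring
  rw [h3]
  exact h2

end Polynomials

/-! ### Regularisation of the products -/

section Regularisation

variable {n N : ℕ}

/-- The smooth positive regularisation `∏ j ∈ S, (|F_j|² + ε) ^ (α_j / 2)` of `absPowProd`. -/
noncomputable def absPowProdReg (F : Fin N → MvPolynomial (Fin n) ℂ) (α : Fin N → ℝ)
    (S : Finset (Fin N)) (ε : ℝ) (w : Fin n → ℂ) : ℝ :=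
  ∏ j ∈ S, (‖MvPolynomial.eval w (F j)‖ ^ 2 + ε) ^ (α j / 2)

variable {F : Fin N → MvPolynomial (Fin n) ℂ} {α : Fin N → ℝ}

theorem hasTemperateGrowth_absPowProdReg (S : Finset (Fin N)) {ε : ℝ} (hε : 0 < ε) :
    HasTemperateGrowth (absPowProdReg F α S ε) :=
  HasTemperateGrowth.prod fun j _ =>
    hasTemperateGrowth_norm_sq_add_rpow (hasTemperateGrowth_eval (F j)) hε (α j / 2)

theorem isPsh_absPowProdReg (hα : ∀ j, 0 ≤ α j) (S : Finset (Fin N)) {ε : ℝ} (hε : 0 < ε) :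
    IsPsh (absPowProdReg F α S ε) := by
  refine IsLogPsh.isPsh (IsLogPsh.prod (fun j _ =>
    hasTemperateGrowth_norm_sq_add_rpow (hasTemperateGrowth_eval (F j)) hε (α j / 2))
    fun j _ => ?_)
  refine IsLogPsh.rpow ?_ (isLogPsh_norm_sq_add (hasTemperateGrowth_eval (F j))
    (contDiff_eval (F j) 2) hε) (by linarith [hα j])
  simpa using hasTemperateGrowth_norm_sq_add_rpow (hasTemperateGrowth_eval (F j)) hε 1

theorem circleInvariant_absPowProdReg (hF : ∀ j, ∃ d : ℕ, (F j).IsHomogeneous d)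
    (S : Finset (Fin N)) (ε : ℝ) : CircleInvariant (absPowProdReg F α S ε) := by
  intro θ w
  refine Finset.prod_congr rfl fun j _ => ?_
  obtain ⟨d, hd⟩ := hF j
  rw [eval_smul_of_isHomogeneous hd, norm_mul, norm_pow, Complex.norm_exp_ofReal_mul_I, one_pow,
    one_mul]

theorem absPowProd_nonneg (S : Finset (Fin N)) (w : Fin n → ℂ) : 0 ≤ absPowProd F α S w :=
  Finset.prod_nonneg fun _ _ => by positivity

theorem norm_sq_rpow_half (z : ℂ) (a : ℝ) : (‖z‖ ^ 2) ^ (a / 2) = ‖z‖ ^ a := by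
  rw [← Real.rpow_natCast, ← Real.rpow_mul (norm_nonneg z)]
  congr 1
  push_cast
  ring

theorem absPowProdReg_zero (S : Finset (Fin N)) (w : Fin n → ℂ) :
    absPowProdReg F α S 0 w = absPowProd F α S w := by
  simp [absPowProdReg, absPowProd, norm_sq_rpow_half]

theorem absPowProdReg_nonneg (S : Finset (Fin N)) {ε : ℝ} (hε : 0 ≤ ε) (w : Fin n → ℂ) :
    0 ≤ absPowProdReg F α S ε w :=
  Finset.prod_nonneg fun _ _ => by positivity

theorem absPowProdReg_mono (hα : ∀ j, 0 ≤ α j) (S : Finset (Fin N)) {ε δ : ℝ} (hε : 0 ≤ ε)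
    (h : ε ≤ δ) (w : Fin n → ℂ) : absPowProdReg F α S ε w ≤ absPowProdReg F α S δ w := by
  refine Finset.prod_le_prod (fun j _ => by positivity) fun j _ => ?_
  have := hα j
  gcongr

theorem continuous_absPowProd (hα : ∀ j, 0 ≤ α j) (S : Finset (Fin N)) :
    Continuous (absPowProd F α S) :=
  continuous_finsetProd _ fun j _ =>
    ((contDiff_eval (F j) 0).continuous.norm).rpow_const fun _ => .inr (hα j)

theorem integrable_absPowProd (hα : ∀ j, 0 ≤ α j) (S : Finset (Fin N)) :
    Integrable (absPowProd F α S) (stdComplexGaussian n) := by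
  refine (integrable_of_hasTemperateGrowth (hasTemperateGrowth_absPowProdReg (F := F) (α := α) S
    one_pos)).mono' (continuous_absPowProd hα S).aestronglyMeasurable (.of_forall fun w => ?_)
  rw [Real.norm_of_nonneg (absPowProd_nonneg S w), ← absPowProdReg_zero]
  exact absPowProdReg_mono hα S le_rfl zero_le_one w

theorem tendsto_integral_absPowProdReg (hα : ∀ j, 0 ≤ α j) (S : Finset (Fin N)) :
    Tendsto (fun k : ℕ => ∫ w, absPowProdReg F α S (1 / ((k : ℝ) + 1)) w ∂stdComplexGaussian n)
      atTop (𝓝 (∫ w, absPowProd F α S w ∂stdComplexGaussian n)) := by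
  have hpos : ∀ k : ℕ, 0 < 1 / ((k : ℝ) + 1) := fun k => by positivity
  refine tendsto_integral_of_dominated_convergence (absPowProdReg F α S 1)
    (fun k => (hasTemperateGrowth_absPowProdReg S (hpos k)).1.continuous.aestronglyMeasurable)
    (integrable_of_hasTemperateGrowth (hasTemperateGrowth_absPowProdReg S one_pos))
    (fun k => .of_forall fun w => ?_) (.of_forall fun w => ?_)
  · rw [Real.norm_of_nonneg (absPowProdReg_nonneg S (hpos k).le w)]
    refine absPowProdReg_mono hα S (hpos k).le ?_ w
    rw [div_le_one (by positivity)]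
    linarith [(Nat.cast_nonneg k : (0 : ℝ) ≤ k)]
  · refine tendsto_finsetProd _ fun j _ => ?_
    rw [← norm_sq_rpow_half]
    have h := (tendsto_one_div_add_atTop_nhds_zero_nat (𝕜 := ℝ)).const_add
      (‖MvPolynomial.eval w (F j)‖ ^ 2)
    rw [add_zero] at h
    exact h.rpow_const (.inr (by linarith [hα j]))

/-- The correlation inequality for products over disjoint sets of indices, obtained from the
regularised products as `ε → 0`. -/
theorem integral_absPowProd_union (hF : ∀ j, ∃ d : ℕ, (F j).IsHomogeneous d)
    (hα : ∀ j, 0 ≤ α j) {S T : Finset (Fin N)} (hST : Disjoint S T) :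
    (∫ w, absPowProd F α S w ∂stdComplexGaussian n) *
      (∫ w, absPowProd F α T w ∂stdComplexGaussian n) ≤
        ∫ w, absPowProd F α (S ∪ T) w ∂stdComplexGaussian n := by
  refine le_of_tendsto_of_tendsto' ((tendsto_integral_absPowProdReg hα S).mul
    (tendsto_integral_absPowProdReg hα T)) (tendsto_integral_absPowProdReg hα (S ∪ T)) fun k => ?_
  have hpos : 0 < 1 / ((k : ℝ) + 1) := by positivity
  have h := IsPsh.integral_mul_le (hasTemperateGrowth_absPowProdReg (F := F) (α := α) S hpos)
    (hasTemperateGrowth_absPowProdReg (F := F) (α := α) T hpos)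
    (circleInvariant_absPowProdReg hF T _) (isPsh_absPowProdReg hα S hpos)
    (isPsh_absPowProdReg hα T hpos)
  refine h.trans_eq (integral_congr_ae (.of_forall fun w => ?_))
  exact (Finset.prod_union hST).symm

theorem prod_integral_le_integral_absPowProd (hF : ∀ j, ∃ d : ℕ, (F j).IsHomogeneous d)
    (hα : ∀ j, 0 ≤ α j) (S : Finset (Fin N)) :
    ∏ j ∈ S, ∫ w, ‖MvPolynomial.eval w (F j)‖ ^ α j ∂stdComplexGaussian n ≤
      ∫ w, absPowProd F α S w ∂stdComplexGaussian n := by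
  induction S using Finset.induction_on with
  | empty => simp [absPowProd]
  | insert j S hj ih =>
    have h := integral_absPowProd_union hF hα (Finset.disjoint_singleton_left.2 hj)
    rw [Finset.prod_insert hj, Finset.insert_eq]
    refine le_trans ?_ h
    have h1 : ∫ w, absPowProd F α {j} w ∂stdComplexGaussian n =
        ∫ w, ‖MvPolynomial.eval w (F j)‖ ^ α j ∂stdComplexGaussian n := by simp [absPowProd]
    rw [h1]
    exact mul_le_mul_of_nonneg_left ih (integral_nonneg fun w => by positivity)

end Regularisation

theorem theorem2 (n N k : ℕ) (hk : k < N)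
    (F : Fin N → MvPolynomial (Fin n) ℂ) (hF : ∀ j, ∃ d : ℕ, (F j).IsHomogeneous d)
    (α : Fin N → ℝ) (hα : ∀ j, 0 ≤ α j) :
    (∀ S : Finset (Fin N), Integrable (absPowProd F α S) (stdComplexGaussian n)) ∧
    (∫ w, absPowProd F α Finset.univ w ∂(stdComplexGaussian n) ≥
      (∫ w, absPowProd F α {j | (j : ℕ) < k} w ∂(stdComplexGaussian n)) *
        (∫ w, absPowProd F α {j | k ≤ (j : ℕ)} w ∂(stdComplexGaussian n))) ∧
    ((∫ w, absPowProd F α {j | (j : ℕ) < k} w ∂(stdComplexGaussian n)) *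
        (∫ w, absPowProd F α {j | k ≤ (j : ℕ)} w ∂(stdComplexGaussian n)) ≥
      ∏ j, ∫ w, ‖MvPolynomial.eval w (F j)‖ ^ α j ∂(stdComplexGaussian n)) := by
  have hdisj : Disjoint ({j | (j : ℕ) < k} : Finset (Fin N)) ({j | k ≤ (j : ℕ)} : Finset (Fin N)) :=
    Finset.disjoint_left.2 fun j h1 h2 => by simp at h1 h2; omega
  have hunion : (Finset.univ : Finset (Fin N)) =
      ({j | (j : ℕ) < k} : Finset (Fin N)) ∪ ({j | k ≤ (j : ℕ)} : Finset (Fin N)) := by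
    ext j
    simp [lt_or_ge]
  refine ⟨integrable_absPowProd hα, ?_, ?_⟩
  · have h := integral_absPowProd_union hF hα hdisj
    rwa [← hunion] at h
  · have hprod : ∀ u : Fin N → ℝ, ∏ j, u j =
        (∏ j ∈ ({j | (j : ℕ) < k} : Finset (Fin N)), u j) *
          ∏ j ∈ ({j | k ≤ (j : ℕ)} : Finset (Fin N)), u j := fun u => by
      rw [← Finset.prod_union hdisj, ← hunion]
    rw [hprod]
    exact mul_le_mul (prod_integral_le_integral_absPowProd hF hα _)
      (prod_integral_le_integral_absPowProd hF hα _)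
      (Finset.prod_nonneg fun j _ => integral_nonneg fun w => by positivity)
      (integral_nonneg fun w => absPowProd_nonneg _ w)
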